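/- For $m\ge 0$, let the Aztec diamond of order $m$ be the union of all unit squares $[a,a+1]\times[b,b+1]$, $a,b\in\mathbb{Z}$, that lie inside the contour $|x|+|y|=m+1$, and let $AD(m)$ be its dual graph: the vertices are these unit squares, and two of them are adjacent when they share an edge. Let $M(G)$ denote the number of perfect matchings of a finite graph $G$ (the empty graph has exactly one). Let $\mathcal{A}_n$ be the set of all $n\times n$ alternating sign matrices, i.e. matrices with entries in $\{0,1,-1\}$ whose row sums and column sums all equal $1$ and whose nonzero entries alternate in sign along each row and each column. For $A\in\mathcal{A}_n$ let $N_-(A)$ be the number of entries of $A$ equal to $-1$. Then for every integer $n\ge 1$, $$M(AD(n-1))=\sum_{A\in\mathcal{A}_n}2^{N_-(A)}.$$ -/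

import Mathlib

namespace AztecASM

/-- The closed unit square `[a, a+1] × [b, b+1]` of the plane, indexed by its lower left corner
`c = (a, b)` in the integer lattice. -/
def unitSquare (c : ℤ × ℤ) : Set (ℝ × ℝ) :=
  Set.Icc (c.1 : ℝ) (c.1 + 1) ×ˢ Set.Icc (c.2 : ℝ) (c.2 + 1)

/-- The unit squares of the Aztec diamond of order `n`: those lying inside the contour
`|x| + |y| = n + 1`. -/
def cells (n : ℕ) : Set (ℤ × ℤ) :=
  {c | unitSquare c ⊆ {p : ℝ × ℝ | |p.1| + |p.2| ≤ (n : ℝ) + 1}}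

/-- It is enough to test the four corners of a unit square. -/
theorem mem_cells_iff (n : ℕ) (c : ℤ × ℤ) :
    c ∈ cells n ↔ max |c.1| |c.1 + 1| + max |c.2| |c.2 + 1| ≤ (n : ℤ) + 1 := by
  constructor
  · intro h
    have corner : ∀ x y : ℤ, (x = c.1 ∨ x = c.1 + 1) → (y = c.2 ∨ y = c.2 + 1) →
        |x| + |y| ≤ (n : ℤ) + 1 := by
      intro x y hx hy
      have hm : ((x : ℝ), (y : ℝ)) ∈ unitSquare c := by
        rcases hx with rfl | rfl <;> rcases hy with rfl | rfl <;> simp [unitSquare]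
      have := h hm
      simp only [Set.mem_ofPred_eq] at this
      exact_mod_cast this
    have h1 := corner c.1 c.2 (Or.inl rfl) (Or.inl rfl)
    have h2 := corner c.1 (c.2 + 1) (Or.inl rfl) (Or.inr rfl)
    have h3 := corner (c.1 + 1) c.2 (Or.inr rfl) (Or.inl rfl)
    have h4 := corner (c.1 + 1) (c.2 + 1) (Or.inr rfl) (Or.inr rfl)
    rcases max_cases |c.1| |c.1 + 1| with ⟨e, -⟩ | ⟨e, -⟩ <;>
      rcases max_cases |c.2| |c.2 + 1| with ⟨e', -⟩ | ⟨e', -⟩ <;> rw [e, e'] <;> assumption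
  · rintro h ⟨x, y⟩ ⟨⟨hx1, hx2⟩, hy1, hy2⟩
    have hx : |x| ≤ max |(c.1 : ℝ)| |(c.1 : ℝ) + 1| := abs_le_max_abs_abs hx1 hx2
    have hy : |y| ≤ max |(c.2 : ℝ)| |(c.2 : ℝ) + 1| := abs_le_max_abs_abs hy1 hy2
    have h' : max |(c.1 : ℝ)| |(c.1 : ℝ) + 1| + max |(c.2 : ℝ)| |(c.2 : ℝ) + 1| ≤ (n : ℝ) + 1 := by
      exact_mod_cast h
    exact (add_le_add hx hy).trans h'

/-- The Aztec diamond has finitely many unit squares. -/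
instance finite_cells (n : ℕ) : Finite (cells n) := by
  refine Set.Finite.to_subtype
    (((Set.finite_Icc (-(n : ℤ) - 1) (n + 1)).prod (Set.finite_Icc (-(n : ℤ) - 1) (n + 1))).subset ?_)
  intro c hc
  rw [mem_cells_iff] at hc
  have h1 := le_max_left |c.1| |c.1 + 1|
  have h2 := le_max_left |c.2| |c.2 + 1|
  have h3 := abs_le.mp (show |c.1| ≤ (n : ℤ) + 1 by linarith [abs_nonneg c.2])
  have h4 := abs_le.mp (show |c.2| ≤ (n : ℤ) + 1 by linarith [abs_nonneg c.1])
  simp only [Set.mem_prod, Set.mem_Icc]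
  omega

/-- The (planar dual) graph of the Aztec diamond of order `n`: its vertices are the unit squares,
and two unit squares are adjacent when they share an edge. -/
def graph (n : ℕ) : SimpleGraph (cells n) where
  Adj c d := (c.1.1 = d.1.1 ∧ |c.1.2 - d.1.2| = 1) ∨ (c.1.2 = d.1.2 ∧ |c.1.1 - d.1.1| = 1)
  symm := ⟨by
    rintro c d (⟨h, h'⟩ | ⟨h, h'⟩)
    · exact Or.inl ⟨h.symm, by rwa [abs_sub_comm]⟩
    · exact Or.inr ⟨h.symm, by rwa [abs_sub_comm]⟩⟩
  loopless := ⟨by rintro c (⟨-, h⟩ | ⟨-, h⟩) <;> simp at h⟩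

/-- The number of perfect matchings of a graph on a finite vertex set. -/
noncomputable def numPerfectMatchings {V : Type*} [Finite V] (G : SimpleGraph V) : ℕ :=
  Nat.card {M : G.Subgraph // M.IsPerfectMatching}

/-- The nonzero entries of the sequence `v` alternate in sign: any two consecutive nonzero
entries (nonzero entries with only zeros in between) have opposite signs. -/
def Alternates {n : ℕ} (v : Fin n → ℤ) : Prop :=
  ∀ i j : Fin n, i < j → v i ≠ 0 → v j ≠ 0 → (∀ k, i < k → k < j → v k = 0) →
    SignType.sign (v j) = -SignType.sign (v i)

/-- Alternating sign matrices of order `n`. -/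
structure IsASM {n : ℕ} (A : Matrix (Fin n) (Fin n) ℤ) : Prop where
  entries : ∀ i j, A i j = 0 ∨ A i j = 1 ∨ A i j = -1
  row_sum : ∀ i, ∑ j, A i j = 1
  col_sum : ∀ j, ∑ i, A i j = 1
  row_alternates : ∀ i, Alternates fun j => A i j
  col_alternates : ∀ j, Alternates fun i => A i j

theorem finite_setOf_isASM (n : ℕ) : {A : Matrix (Fin n) (Fin n) ℤ | IsASM A}.Finite := by
  refine (Set.Finite.pi' (t := fun _ : Fin n => {r : Fin n → ℤ | ∀ j, r j ∈ ({0, 1, -1} : Set ℤ)})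
    fun _ => Set.Finite.pi' fun _ => Set.toFinite _).subset ?_
  intro A hA i j
  simpa using hA.entries i j

/-- The finite set of all alternating sign matrices of order `n`. -/
noncomputable def asm (n : ℕ) : Finset (Matrix (Fin n) (Fin n) ℤ) :=
  (finite_setOf_isASM n).toFinset

/-- The number of entries of `A` equal to `-1`. -/
def numNegOnes {n : ℕ} (A : Matrix (Fin n) (Fin n) ℤ) : ℕ :=
  (Finset.univ.filter fun p : Fin n × Fin n => A p.1 p.2 = -1).card

end AztecASM

namespace AztecASM

/-! Seen at 45 degrees, the squares of the Aztec diamond of order `n - 1` are the edges of an `n ×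
n` grid graph, and two squares share a side exactly when one is a horizontal and the other a
vertical grid edge with a common end. A perfect matching therefore assigns each grid edge to one of
its ends and pairs, at each grid point, the horizontal edges assigned there with the vertical ones
(`numPerfectMatchings_graph`).

Put `1` minus the number of pairs at each point into a matrix `A`. Along a row, each edge goes to
exactly one end and none leaves the grid, so the assignment is recovered from the partial sums of
`A` (`isLineCover_iff`); columns behave alike. Assignments take values in `{0, 1}`, which says that
the partial sums do, and this together with total `1` characterises the lines of an alternating sign
matrix (`isASMLine_iff`).

Conversely, `A` fixes which edges meet at each point, and only the pairing is free: two ways if all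
four edges are present, that is, at an entry `-1`, and one way otherwise (`card_hasDegrees`).
Summing over the fibres of `toMatrix` gives the formula. -/

/-! ### Alternating sign conditions in terms of partial sums -/

/-- The sum of the first `k` entries of `v`. -/
def partialSum {n : ℕ} (v : Fin n → ℤ) (k : ℕ) : ℤ :=
  ∑ j : Fin n with j.val < k, v j

theorem partialSum_zero {n : ℕ} (v : Fin n → ℤ) : partialSum v 0 = 0 := by
  simp [partialSum]

theorem partialSum_self {n : ℕ} (v : Fin n → ℤ) : partialSum v n = ∑ j, v j := by
  simp [partialSum]

theorem partialSum_succ {n : ℕ} (v : Fin n → ℤ) (j : Fin n) :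
    partialSum v (j + 1) = partialSum v j + v j := by
  have h : (Finset.univ.filter fun k : Fin n => k.val < j.val + 1) =
      insert j (Finset.univ.filter fun k : Fin n => k.val < j.val) := by
    ext k
    simp only [Finset.mem_filter, Finset.mem_univ, true_and, Finset.mem_insert, Fin.ext_iff]
    omega
  rw [partialSum, h, Finset.sum_insert (by simp), partialSum, add_comm]

theorem partialSum_eq_of_zero_between {n : ℕ} (v : Fin n → ℤ) {a b : ℕ} (hab : a ≤ b) (hb : b ≤ n)
    (h : ∀ k : Fin n, a ≤ k.val → k.val < b → v k = 0) : partialSum v b = partialSum v a := by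
  induction b, hab using Nat.le_induction with
  | base => rfl
  | succ b hab ih =>
    have := partialSum_succ v ⟨b, hb⟩
    simp only at this
    rw [this, h ⟨b, hb⟩ hab (Nat.lt_succ_self b), add_zero]
    exact ih (by omega) fun k hk hk' => h k hk (by omega)

/-- Partial sums are constant between consecutive nonzero entries, so the second entry must undo the
first for them to stay in `{0, 1}`. -/
theorem alternates_of_partialSum {n : ℕ} {v : Fin n → ℤ}
    (h : ∀ k ≤ n, partialSum v k = 0 ∨ partialSum v k = 1) : Alternates v := by
  intro i j hij hi hj hz
  have e := partialSum_eq_of_zero_between v (a := i + 1) (b := j) hij j.2.le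
    fun k hk hk' => hz k hk hk'
  have hi1 := partialSum_succ v i
  have hj1 := partialSum_succ v j
  have h1 := h i i.2.le
  have h2 := h (i + 1) i.2
  have h3 := h (j + 1) j.2
  have : (v i = 1 ∧ v j = -1) ∨ (v i = -1 ∧ v j = 1) := by omega
  rcases this with ⟨e1, e2⟩ | ⟨e1, e2⟩ <;> rw [e1, e2] <;> decide

theorem partialSum_of_alternates {n : ℕ} {v : Fin n → ℤ}
    (he : ∀ j, v j = 0 ∨ v j = 1 ∨ v j = -1) (ha : Alternates v) :
    ∃ ε : ℤ, (ε = 1 ∨ ε = -1) ∧ ∀ k ≤ n, partialSum v k = 0 ∨ partialSum v k = ε := by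
  -- The sign `ε` is that of the first nonzero entry, arbitrary while there is none. Carrying the
  -- last nonzero entry `l` along tells whether the current sum is `ε` or `0`, hence where the next
  -- nonzero entry leads.
  have key : ∀ k ≤ n, ∃ ε : ℤ, (ε = 1 ∨ ε = -1) ∧
      (∀ k' ≤ k, partialSum v k' = 0 ∨ partialSum v k' = ε) ∧
      ((∀ k' ≤ k, partialSum v k' = 0) ∨ ∃ l : Fin n, l.val < k ∧ v l ≠ 0 ∧
        (∀ i : Fin n, l < i → i.val < k → v i = 0) ∧
        ((v l = ε ∧ partialSum v k = ε) ∨ (v l = -ε ∧ partialSum v k = 0))) := by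
    intro k
    induction k with
    | zero =>
      intro _
      refine ⟨1, Or.inl rfl, ?_, Or.inl ?_⟩ <;> intro k' hk' <;>
        obtain rfl : k' = 0 := by omega
      · exact Or.inl (partialSum_zero v)
      · exact partialSum_zero v
    | succ k ih =>
      intro hk
      obtain ⟨ε, hε, hall, hlast⟩ := ih (by omega)
      have hs := partialSum_succ v ⟨k, hk⟩
      simp only at hs
      by_cases h0 : v ⟨k, hk⟩ = 0
      · rw [h0, add_zero] at hs
        refine ⟨ε, hε, ?_, ?_⟩
        · intro k' hk'
          rcases Nat.lt_or_ge k k' with h | h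
          · obtain rfl : k' = k + 1 := by omega
            rw [hs]; exact hall k le_rfl
          · exact hall k' h
        · rcases hlast with hz | ⟨l, hl, hl0, hlz, hlv⟩
          · left
            intro k' hk'
            rcases Nat.lt_or_ge k k' with h | h
            · obtain rfl : k' = k + 1 := by omega
              rw [hs]; exact hz k le_rfl
            · exact hz k' h
          · refine Or.inr ⟨l, by omega, hl0, ?_, by rwa [hs]⟩
            intro i hi hik
            rcases Nat.lt_or_ge i.val k with h | h
            · exact hlz i hi h
            · obtain rfl : i = ⟨k, hk⟩ := Fin.ext (by simp only; omega)
              exact h0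
      · rcases hlast with hz | ⟨l, hl, hl0, hlz, hlv⟩
        · have hk1 : partialSum v (k + 1) = v ⟨k, hk⟩ := by rw [hs, hz k le_rfl, zero_add]
          refine ⟨v ⟨k, hk⟩, (he _).resolve_left h0, ?_, Or.inr ⟨⟨k, hk⟩, by simp, h0, ?_,
            Or.inl ⟨rfl, hk1⟩⟩⟩
          · intro k' hk'
            rcases Nat.lt_or_ge k k' with h | h
            · obtain rfl : k' = k + 1 := by omega
              exact Or.inr hk1
            · exact Or.inl (hz k' h)
          · intro i hi hik
            simp only [Fin.lt_def] at hi
            omega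
        · have hsign := ha l ⟨k, hk⟩ hl hl0 h0 fun i hi hik => hlz i hi hik
          have hopp : v ⟨k, hk⟩ = - v l := by
            rcases (he l).resolve_left hl0 with e | e <;>
              rcases (he ⟨k, hk⟩).resolve_left h0 with e' | e' <;> rw [e, e'] at hsign ⊢ <;>
              first | rfl | (exact absurd hsign (by decide))
          have hk1 : (v ⟨k, hk⟩ = ε ∧ partialSum v (k + 1) = ε) ∨
              (v ⟨k, hk⟩ = -ε ∧ partialSum v (k + 1) = 0) := by omega
          refine ⟨ε, hε, ?_, Or.inr ⟨⟨k, hk⟩, by simp, h0, ?_, hk1⟩⟩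
          · intro k' hk'
            rcases Nat.lt_or_ge k k' with h | h
            · obtain rfl : k' = k + 1 := by omega
              omega
            · exact hall k' h
          · intro i hi hik
            simp only [Fin.lt_def] at hi
            omega
  obtain ⟨ε, hε, h, -⟩ := key n le_rfl
  exact ⟨ε, hε, h⟩

/-- Sequences with total `1` and partial sums in `{0, 1}`. -/
def IsASMLine {n : ℕ} (v : Fin n → ℤ) : Prop :=
  partialSum v n = 1 ∧ ∀ k ≤ n, partialSum v k = 0 ∨ partialSum v k = 1

theorem isASMLine_iff {n : ℕ} (v : Fin n → ℤ) :
    IsASMLine v ↔ (∀ j, v j = 0 ∨ v j = 1 ∨ v j = -1) ∧ ∑ j, v j = 1 ∧ Alternates v := by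
  constructor
  · rintro ⟨h1, h2⟩
    refine ⟨fun j => ?_, by rw [← partialSum_self, h1], alternates_of_partialSum h2⟩
    have := partialSum_succ v j
    have := h2 j j.2.le
    have := h2 (j + 1) j.2
    omega
  · rintro ⟨h1, h2, h3⟩
    rw [← partialSum_self] at h2
    refine ⟨h2, ?_⟩
    obtain ⟨ε, hε, h⟩ := partialSum_of_alternates h1 h3
    have := h n le_rfl
    -- The total `1` is itself a partial sum, which excludes `ε = -1`.
    obtain rfl : ε = 1 := by omega
    exact h

theorem isASM_iff {n : ℕ} (A : Matrix (Fin n) (Fin n) ℤ) :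
    IsASM A ↔ (∀ i, IsASMLine fun j => A i j) ∧ ∀ j, IsASMLine fun i => A i j := by
  simp only [isASMLine_iff]
  constructor
  · intro h
    exact ⟨fun i => ⟨h.entries i, h.row_sum i, h.row_alternates i⟩,
      fun j => ⟨fun i => h.entries i j, h.col_sum j, h.col_alternates j⟩⟩
  · rintro ⟨h1, h2⟩
    exact ⟨fun i => (h1 i).1, fun i => (h1 i).2.1, fun j => (h2 j).2.1, fun i => (h1 i).2.2,
      fun j => (h2 j).2.2⟩

/-! ### Assigning the edges of a path to their ends -/

/-- Every edge of a path on `n` vertices is chosen by exactly one of its two ends, where `l` and `r`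
count how often a vertex chooses the edge to its left and to its right. -/
def IsLineCover {n : ℕ} (l r : Fin n → ℤ) : Prop :=
  (∀ j : Fin n, j.val = 0 → l j = 0) ∧ (∀ j : Fin n, j.val + 1 = n → r j = 0) ∧
    ∀ j k : Fin n, k.val = j.val + 1 → r j + l k = 1

/-- The cover is solved from left to right: `l` starts at `0`, `v j` yields `r j` from `l j`, and
the edge condition yields the next `l`. The boundary condition at the right end becomes the total
`1`. -/
theorem isLineCover_iff {n : ℕ} (hn : 0 < n) {l r v : Fin n → ℤ} (hv : ∀ j, v j = 1 - l j - r j) :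
    IsLineCover l r ↔
      partialSum v n = 1 ∧ ∀ j, l j = partialSum v j ∧ r j = 1 - partialSum v (j + 1) := by
  constructor
  · rintro ⟨h0, h1, h2⟩
    have hl : ∀ k (hk : k < n), l ⟨k, hk⟩ = partialSum v k := by
      intro k
      induction k with
      | zero => intro hk; rw [h0 _ rfl, partialSum_zero]
      | succ k ih =>
        intro hk
        have := ih (by omega)
        have := h2 ⟨k, by omega⟩ ⟨k + 1, hk⟩ rfl
        have := partialSum_succ v ⟨k, by omega⟩
        have := hv ⟨k, by omega⟩
        simp only at *
        omega
    have hr : ∀ j, r j = 1 - partialSum v (j + 1) := by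
      intro j
      have := hl j j.2
      have := partialSum_succ v j
      have := hv j
      simp only [Fin.eta] at *
      omega
    refine ⟨?_, fun j => ⟨hl j j.2, hr j⟩⟩
    have e1 := hr ⟨n - 1, by omega⟩
    have e2 := h1 ⟨n - 1, by omega⟩ (by simp only; omega)
    simp only [Nat.sub_add_cancel hn] at e1
    omega
  · rintro ⟨h1, h2⟩
    refine ⟨fun j hj => ?_, fun j hj => ?_, fun j k hk => ?_⟩
    · rw [(h2 j).1, hj, partialSum_zero]
    · rw [(h2 j).2, hj, h1, sub_self]
    · rw [(h2 j).2, (h2 k).1, hk]; ring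

/-- An interior partial sum at `k` equals both `l k ≥ 0` and `1 - r (k - 1) ≤ 1`. -/
theorem IsLineCover.isASMLine {n : ℕ} (hn : 0 < n) {l r v : Fin n → ℤ}
    (hv : ∀ j, v j = 1 - l j - r j) (h : IsLineCover l r) (hl : ∀ j, 0 ≤ l j) (hr : ∀ j, 0 ≤ r j) :
    IsASMLine v := by
  obtain ⟨h1, h2⟩ := (isLineCover_iff hn hv).1 h
  refine ⟨h1, fun k hk => ?_⟩
  rcases Nat.eq_zero_or_pos k with rfl | hk0
  · exact Or.inl (partialSum_zero v)
  rcases hk.lt_or_eq with hk' | rfl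
  · have e1 := (h2 ⟨k - 1, by omega⟩).2
    have e2 := (h2 ⟨k, hk'⟩).1
    simp only [Nat.sub_add_cancel hk0] at e1
    have := hr ⟨k - 1, by omega⟩
    have := hl ⟨k, hk'⟩
    simp only at e2
    omega
  · exact Or.inr h1

/-! ### Local states and the count over a fixed matrix -/

/-- The number of edges of the local state `x` at its left (`false`) or right (`true`) side. -/
def hDegree (x : Bool → Bool → Bool) (d : Bool) : ℤ :=
  ((x d false).toNat + (x d true).toNat : ℕ)

/-- The number of edges of the local state `x` at its lower (`false`) or upper (`true`) side. -/
def vDegree (x : Bool → Bool → Bool) (u : Bool) : ℤ :=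
  ((x false u).toNat + (x true u).toNat : ℕ)

theorem hDegree_add_hDegree (x : Bool → Bool → Bool) :
    hDegree x false + hDegree x true = vDegree x false + vDegree x true := by
  simp only [hDegree, vDegree]
  push_cast
  ring

theorem hDegree_nonneg (x : Bool → Bool → Bool) (d : Bool) : 0 ≤ hDegree x d :=
  Int.natCast_nonneg _

theorem vDegree_nonneg (x : Bool → Bool → Bool) (u : Bool) : 0 ≤ vDegree x u :=
  Int.natCast_nonneg _

/-- The local state `x` has prescribed degrees at its four sides. -/
def HasDegrees (l r d u : ℤ) (x : Bool → Bool → Bool) : Prop :=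
  hDegree x false = l ∧ hDegree x true = r ∧ vDegree x false = d ∧ vDegree x true = u

instance (l r d u : ℤ) : DecidablePred (HasDegrees l r d u) := fun _ =>
  inferInstanceAs (Decidable (_ ∧ _))

/-- The local graph is a 4-cycle of two horizontal and two vertical sides: with all four sides used
it has two perfect matchings; otherwise the used sides force at most one pair. -/
theorem card_hasDegrees {l r d u : ℤ} (hl : l = 0 ∨ l = 1) (hr : r = 0 ∨ r = 1)
    (hd : d = 0 ∨ d = 1) (hu : u = 0 ∨ u = 1) (h : l + r = d + u) :
    (Finset.univ.filter (HasDegrees l r d u)).card = if l + r = 2 then 2 else 1 := by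
  rcases hl with rfl | rfl <;> rcases hr with rfl | rfl <;> rcases hd with rfl | rfl <;>
    rcases hu with rfl | rfl <;> first | (exact absurd h (by decide)) | decide

/-- A local state at each point of the `n × n` grid. -/
abbrev Config (n : ℕ) := Fin n → Fin n → Bool → Bool → Bool

/-- Each edge of the grid is used exactly once, and no edge leaves the grid. -/
def IsCover {n : ℕ} (X : Config n) : Prop :=
  (∀ i, IsLineCover (fun j => hDegree (X i j) false) fun j => hDegree (X i j) true) ∧
    ∀ j, IsLineCover (fun i => vDegree (X i j) false) fun i => vDegree (X i j) true

/-- One minus the number of edges of the local states. -/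
def toMatrix {n : ℕ} (X : Config n) : Matrix (Fin n) (Fin n) ℤ :=
  fun i j => 1 - hDegree (X i j) false - hDegree (X i j) true

/-- The configurations with degrees given by the partial sums of `A`. -/
def HasMatrix {n : ℕ} (A : Matrix (Fin n) (Fin n) ℤ) (X : Config n) : Prop :=
  ∀ i j : Fin n, HasDegrees (partialSum (fun k => A i k) j) (1 - partialSum (fun k => A i k) (j + 1))
    (partialSum (fun k => A k j) i) (1 - partialSum (fun k => A k j) (i + 1)) (X i j)

theorem toMatrix_eq_vDegree {n : ℕ} (X : Config n) (i j : Fin n) :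
    toMatrix X i j = 1 - vDegree (X i j) false - vDegree (X i j) true := by
  have := hDegree_add_hDegree (X i j)
  simp only [toMatrix]
  omega

theorem isCover_iff {n : ℕ} (hn : 0 < n) (X : Config n) :
    IsCover X ↔ IsASM (toMatrix X) ∧ HasMatrix (toMatrix X) X := by
  have hrow (i : Fin n) := isLineCover_iff hn (l := fun j => hDegree (X i j) false)
    (r := fun j => hDegree (X i j) true) (v := fun j => toMatrix X i j) fun j => rfl
  have hcol (j : Fin n) := isLineCover_iff hn (l := fun i => vDegree (X i j) false)
    (r := fun i => vDegree (X i j) true) (v := fun i => toMatrix X i j)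
    fun i => toMatrix_eq_vDegree X i j
  rw [isASM_iff]
  constructor
  · rintro ⟨h1, h2⟩
    refine ⟨⟨fun i => (h1 i).isASMLine hn (fun j => rfl) (fun j => hDegree_nonneg _ _)
      fun j => hDegree_nonneg _ _, fun j => (h2 j).isASMLine hn
      (fun i => toMatrix_eq_vDegree X i j) (fun j => vDegree_nonneg _ _)
      fun j => vDegree_nonneg _ _⟩, fun i j => ?_⟩
    have e1 := ((hrow i).1 (h1 i)).2 j
    have e2 := ((hcol j).1 (h2 j)).2 i
    exact ⟨e1.1, e1.2, e2.1, e2.2⟩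
  · rintro ⟨⟨h1, h2⟩, h⟩
    exact ⟨fun i => (hrow i).2 ⟨(h1 i).1, fun j => ⟨(h i j).1, (h i j).2.1⟩⟩,
      fun j => (hcol j).2 ⟨(h2 j).1, fun i => ⟨(h i j).2.2.1, (h i j).2.2.2⟩⟩⟩

theorem HasMatrix.toMatrix_eq {n : ℕ} {A : Matrix (Fin n) (Fin n) ℤ} {X : Config n}
    (h : HasMatrix A X) : toMatrix X = A := by
  ext i j
  have := partialSum_succ (fun k => A i k) j
  simp only [toMatrix, (h i j).1, (h i j).2.1] at *
  omega

/-- Once `A` prescribes all degrees, the grid points are independent, so the count is a product of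
local counts. -/
theorem card_hasMatrix {n : ℕ} {A : Matrix (Fin n) (Fin n) ℤ} (hA : IsASM A) :
    Nat.card {X : Config n // HasMatrix A X} = 2 ^ numNegOnes A := by
  obtain ⟨h1, h2⟩ := (isASM_iff A).1 hA
  have hloc (i j : Fin n) : Nat.card {x // HasDegrees (partialSum (fun k => A i k) j)
      (1 - partialSum (fun k => A i k) (j + 1)) (partialSum (fun k => A k j) i)
      (1 - partialSum (fun k => A k j) (i + 1)) x} = if A i j = -1 then 2 else 1 := by
    have r1 := (h1 i).2 j j.2.le
    have r2 := (h1 i).2 (j + 1) j.2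
    have r3 : partialSum (fun k => A i k) (j + 1) = partialSum (fun k => A i k) j + A i j :=
      partialSum_succ (fun k => A i k) j
    have c1 := (h2 j).2 i i.2.le
    have c2 := (h2 j).2 (i + 1) i.2
    have c3 : partialSum (fun k => A k j) (i + 1) = partialSum (fun k => A k j) i + A i j :=
      partialSum_succ (fun k => A k j) i
    rw [Nat.card_eq_fintype_card, Fintype.card_subtype,
      card_hasDegrees r1 (by omega) c1 (by omega) (by omega)]
    -- Here `l + r = 1 - A i j`, so the sum is `2` exactly at the entries `-1`.
    congr 1
    exact propext (by omega)
  have e : {X : Config n // HasMatrix A X} ≃ ∀ i j : Fin n, {x // HasDegrees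
      (partialSum (fun k => A i k) j) (1 - partialSum (fun k => A i k) (j + 1))
      (partialSum (fun k => A k j) i) (1 - partialSum (fun k => A k j) (i + 1)) x} :=
    { toFun := fun X i j => ⟨X.1 i j, X.2 i j⟩
      invFun := fun Y => ⟨fun i j => (Y i j).1, fun i j => (Y i j).2⟩
      left_inv := fun X => rfl
      right_inv := fun Y => rfl }
  rw [Nat.card_congr e, Nat.card_pi]
  simp only [Nat.card_pi, hloc]
  rw [numNegOnes, ← Fintype.prod_prod_type', Finset.prod_ite]
  simp

theorem card_isCover {n : ℕ} (hn : 0 < n) :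
    Nat.card {X : Config n // IsCover X} = ∑ A ∈ asm n, 2 ^ numNegOnes A := by
  classical
  rw [Nat.card_eq_fintype_card, Fintype.card_subtype,
    Finset.card_eq_sum_card_fiberwise (f := toMatrix) (t := asm n)]
  · refine Finset.sum_congr rfl fun A hA => ?_
    have hA' : IsASM A := by simpa [asm] using hA
    rw [← card_hasMatrix hA', Nat.card_eq_fintype_card, Fintype.card_subtype, Finset.filter_filter]
    congr 1
    ext X
    simp only [Finset.mem_filter, Finset.mem_univ, true_and, isCover_iff hn]
    constructor
    · rintro ⟨⟨-, h⟩, rfl⟩; exact h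
    · intro h; rw [h.toMatrix_eq]; exact ⟨⟨hA', h⟩, rfl⟩
  · intro X hX
    simp only [Finset.coe_filter, Finset.mem_univ, true_and, Set.mem_ofPred_eq, isCover_iff hn] at hX
    simpa [asm] using hX.1

/-! ### Unit squares as edges of the grid -/

/-- The unit square joining the grid points `(i, j)` and `(i, j + 1)`, where the grid point `(i, j)`
stands for the lattice point `(i + j - m, i - j)`. -/
def hCell (m : ℕ) (i j : ℤ) : ℤ × ℤ := (i + j - m, i - j - 1)

/-- The unit square joining the grid points `(i, j)` and `(i + 1, j)`. -/
def vCell (m : ℕ) (i j : ℤ) : ℤ × ℤ := (i + j - m, i - j)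

theorem hCell_mem_cells {m : ℕ} {i j : ℤ} :
    hCell m i j ∈ cells m ↔ 0 ≤ i ∧ i ≤ m ∧ 0 ≤ j ∧ j < m := by
  rw [mem_cells_iff, hCell]
  simp only [abs_eq_max_neg]
  omega

theorem vCell_mem_cells {m : ℕ} {i j : ℤ} :
    vCell m i j ∈ cells m ↔ 0 ≤ i ∧ i < m ∧ 0 ≤ j ∧ j ≤ m := by
  rw [mem_cells_iff, vCell]
  simp only [abs_eq_max_neg]
  omega

theorem hCell_inj {m : ℕ} {i j k l : ℤ} : hCell m i j = hCell m k l ↔ i = k ∧ j = l := by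
  simp only [hCell, Prod.mk.injEq]
  omega

theorem vCell_inj {m : ℕ} {i j k l : ℤ} : vCell m i j = vCell m k l ↔ i = k ∧ j = l := by
  simp only [vCell, Prod.mk.injEq]
  omega

theorem hCell_ne_vCell {m : ℕ} {i j k l : ℤ} : hCell m i j ≠ vCell m k l := by
  simp only [hCell, vCell, ne_eq, Prod.mk.injEq]
  omega

/-- The parity of `a + b + m` decides which diagonal of the square joins lattice points that
represent grid points. -/
theorem exists_eq_hCell_or_vCell (m : ℕ) (c : ℤ × ℤ) :
    ∃ i j, c = hCell m i j ∨ c = vCell m i j := by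
  obtain ⟨a, b⟩ := c
  rcases Int.emod_two_eq_zero_or_one (a + b + m) with h | h
  · refine ⟨(a + b + m) / 2, (a - b + m) / 2, Or.inr ?_⟩
    simp only [vCell, Prod.mk.injEq]
    omega
  · refine ⟨(a + b + m + 1) / 2, (a - b + m - 1) / 2, Or.inl ?_⟩
    simp only [hCell, Prod.mk.injEq]
    omega

/-- Adjacency of unit squares. -/
def CellAdj (c d : ℤ × ℤ) : Prop :=
  (c.1 = d.1 ∧ |c.2 - d.2| = 1) ∨ (c.2 = d.2 ∧ |c.1 - d.1| = 1)

theorem not_cellAdj_hCell_hCell {m : ℕ} {i j k l : ℤ} : ¬ CellAdj (hCell m i j) (hCell m k l) := by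
  simp only [CellAdj, hCell, abs_eq_max_neg]
  omega

theorem not_cellAdj_vCell_vCell {m : ℕ} {i j k l : ℤ} : ¬ CellAdj (vCell m i j) (vCell m k l) := by
  simp only [CellAdj, vCell, abs_eq_max_neg]
  omega

/-- The horizontal edge of the grid at the left (`false`) or right (`true`) of a point. -/
def hEdge (m : ℕ) (i j : ℤ) (d : Bool) : ℤ × ℤ := hCell m i (if d then j else j - 1)

/-- The vertical edge of the grid below (`false`) or above (`true`) a point. -/
def vEdge (m : ℕ) (i j : ℤ) (u : Bool) : ℤ × ℤ := vCell m (if u then i else i - 1) j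

theorem cellAdj_hEdge_vEdge {m : ℕ} {i j : ℤ} {d u : Bool} :
    CellAdj (hEdge m i j d) (vEdge m i j u) := by
  cases d <;> cases u <;> simp [CellAdj, hEdge, vEdge, hCell, vCell, abs_eq_max_neg] <;> omega

theorem CellAdj.symm {c d : ℤ × ℤ} (h : CellAdj c d) : CellAdj d c := by
  simpa only [CellAdj, eq_comm (a := c.1), eq_comm (a := c.2), abs_sub_comm c.1,
    abs_sub_comm c.2] using h

theorem exists_of_cellAdj {m : ℕ} {i j k l : ℤ} (h : CellAdj (hCell m i j) (vCell m k l)) :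
    ∃ a b d u, hCell m i j = hEdge m a b d ∧ vCell m k l = vEdge m a b u := by
  simp only [hEdge, vEdge, hCell_inj, vCell_inj, Bool.exists_bool]
  simp only [CellAdj, hCell, vCell, abs_eq_max_neg] at h
  -- A common end must lie in the row of the horizontal edge and in the column of the vertical one.
  refine ⟨i, l, ?_⟩
  simp
  omega

theorem edges_inj {m : ℕ} {i j k l : ℤ} {d u d' u' : Bool} (h : hEdge m i j d = hEdge m k l d')
    (h' : vEdge m i j u = vEdge m k l u') : i = k ∧ j = l ∧ d = d' ∧ u = u' := by
  simp only [hEdge, vEdge, hCell_inj, vCell_inj] at h h'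
  cases d <;> cases d' <;> cases u <;> cases u' <;> simp at h h' ⊢ <;> omega

/-- The horizontal square bounds the row index and the vertical one bounds the column index. -/
theorem mem_of_edges_mem {m : ℕ} {i j : ℤ} {d u : Bool} (h : hEdge m i j d ∈ cells m)
    (h' : vEdge m i j u ∈ cells m) : ∃ a b : Fin (m + 1), i = (a : ℕ) ∧ j = (b : ℕ) := by
  rw [hEdge, hCell_mem_cells] at h
  rw [vEdge, vCell_mem_cells] at h'
  exact ⟨⟨i.toNat, by omega⟩, ⟨j.toNat, by omega⟩, by simp; omega, by simp; omega⟩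

/-- Each square has four possible partners, two at each end of its grid edge; this turns uniqueness
of the partner into an equation between degrees. -/
theorem existsUnique_iff_sum_decide {α : Type*} {P : α → Prop} {a b c d : α}
    (hd : [a, b, c, d].Nodup) (hP : ∀ w, P w → w = a ∨ w = b ∨ w = c ∨ w = d)
    {pa pb pc pd : Bool} (ha : pa = true ↔ P a) (hb : pb = true ↔ P b) (hc : pc = true ↔ P c)
    (hd' : pd = true ↔ P d) :
    (∃! w, P w) ↔ pa.toNat + pb.toNat + (pc.toNat + pd.toNat) = 1 := by
  simp only [List.nodup_cons, List.mem_cons, List.not_mem_nil, or_false, not_or] at hd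
  obtain ⟨⟨hab, hac, had⟩, ⟨hbc, hbd⟩, hcd, -⟩ := hd
  constructor
  · rintro ⟨w, hw, hu⟩
    have key (x : α) : P x ↔ x = w := ⟨hu x, fun h => h ▸ hw⟩
    rw [key] at ha hb hc hd'
    rcases hP w hw with rfl | rfl | rfl | rfl <;> grind
  · intro h
    cases pa <;> cases pb <;> cases pc <;> cases pd <;> simp at h ha hb hc hd' <;>
      first
        | exact ⟨a, ha, by grind⟩
        | exact ⟨b, hb, by grind⟩
        | exact ⟨c, hc, by grind⟩
        | exact ⟨d, hd', by grind⟩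

/-! ### Covers as matching relations on squares -/

/-- The pairs of a horizontal and a vertical unit square matched by the configuration `X`. -/
def Config.Rel {m : ℕ} (X : Config (m + 1)) (c d : ℤ × ℤ) : Prop :=
  ∃ (i j : Fin (m + 1)) (s u : Bool), X i j s u = true ∧
    c = hEdge m (i : ℕ) (j : ℕ) s ∧ d = vEdge m (i : ℕ) (j : ℕ) u

theorem Config.rel_edges {m : ℕ} (X : Config (m + 1)) (i j : Fin (m + 1)) (s u : Bool) :
    X.Rel (hEdge m (i : ℕ) (j : ℕ) s) (vEdge m (i : ℕ) (j : ℕ) u) ↔ X i j s u = true := by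
  constructor
  · rintro ⟨k, l, s', u', h, h1, h2⟩
    obtain ⟨e1, e2, rfl, rfl⟩ := edges_inj h1 h2
    obtain rfl : i = k := Fin.ext (by omega)
    obtain rfl : j = l := Fin.ext (by omega)
    exact h
  · exact fun h => ⟨i, j, s, u, h, rfl, rfl⟩

theorem hDegree_eq_zero {x : Bool → Bool → Bool} {s : Bool} :
    hDegree x s = 0 ↔ ∀ u, x s u = false := by
  rw [hDegree, Bool.forall_bool]
  cases x s false <;> cases x s true <;> simp

theorem vDegree_eq_zero {x : Bool → Bool → Bool} {u : Bool} :
    vDegree x u = 0 ↔ ∀ s, x s u = false := by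
  rw [vDegree, Bool.forall_bool]
  cases x false u <;> cases x true u <;> simp

theorem Config.existsUnique_rel_hCell {m : ℕ} (X : Config (m + 1)) {i j k : Fin (m + 1)}
    (hk : k.val = j.val + 1) :
    (∃! w, X.Rel (hCell m (i : ℕ) (j : ℕ)) w) ↔
      hDegree (X i j) true + hDegree (X i k) false = 1 := by
  have h1 : hCell m (i : ℕ) (j : ℕ) = hEdge m (i : ℕ) (j : ℕ) true := by simp [hEdge]
  have h2 : hCell m (i : ℕ) (j : ℕ) = hEdge m (i : ℕ) (k : ℕ) false := by simp [hEdge, hk]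
  rw [existsUnique_iff_sum_decide (a := vEdge m (i : ℕ) (j : ℕ) false)
    (b := vEdge m (i : ℕ) (j : ℕ) true) (c := vEdge m (i : ℕ) (k : ℕ) false)
    (d := vEdge m (i : ℕ) (k : ℕ) true) (pa := X i j true false) (pb := X i j true true)
    (pc := X i k false false) (pd := X i k false true)]
  · simp only [hDegree]
    omega
  · simp [vEdge, vCell_inj, hk]
  · rintro w ⟨a, b, s, u, -, h, rfl⟩
    rw [hEdge, hCell_inj] at h
    simp only [vEdge, vCell_inj]
    cases s <;> cases u <;> simp at h ⊢ <;> omega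
  · rw [h1, rel_edges]
  · rw [h1, rel_edges]
  · rw [h2, rel_edges]
  · rw [h2, rel_edges]

theorem Config.existsUnique_rel_vCell {m : ℕ} (X : Config (m + 1)) {i j k : Fin (m + 1)}
    (hk : k.val = i.val + 1) :
    (∃! w, X.Rel w (vCell m (i : ℕ) (j : ℕ))) ↔
      vDegree (X i j) true + vDegree (X k j) false = 1 := by
  have h1 : vCell m (i : ℕ) (j : ℕ) = vEdge m (i : ℕ) (j : ℕ) true := by simp [vEdge]
  have h2 : vCell m (i : ℕ) (j : ℕ) = vEdge m (k : ℕ) (j : ℕ) false := by simp [vEdge, hk]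
  rw [existsUnique_iff_sum_decide (a := hEdge m (i : ℕ) (j : ℕ) false)
    (b := hEdge m (i : ℕ) (j : ℕ) true) (c := hEdge m (k : ℕ) (j : ℕ) false)
    (d := hEdge m (k : ℕ) (j : ℕ) true) (pa := X i j false true) (pb := X i j true true)
    (pc := X k j false false) (pd := X k j true false)]
  · simp only [vDegree]
    omega
  · simp [hEdge, hCell_inj, hk]
  · rintro w ⟨a, b, s, u, -, rfl, h⟩
    rw [vEdge, vCell_inj] at h
    simp only [hEdge, hCell_inj]
    cases s <;> cases u <;> simp at h ⊢ <;> omega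
  · rw [h1, rel_edges]
  · rw [h1, rel_edges]
  · rw [h2, rel_edges]
  · rw [h2, rel_edges]

/-- The two boundary conditions say that no square outside the diamond is used; the edge conditions
say that each horizontal square of the row has one partner. -/
theorem Config.isLineCover_row_iff {m : ℕ} (X : Config (m + 1)) (i : Fin (m + 1)) :
    IsLineCover (fun j => hDegree (X i j) false) (fun j => hDegree (X i j) true) ↔
      (∀ j s u, X i j s u = true → hEdge m (i : ℕ) (j : ℕ) s ∈ cells m) ∧
        ∀ j, hCell m (i : ℕ) j ∈ cells m → ∃! w, X.Rel (hCell m (i : ℕ) j) w := by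
  constructor
  · rintro ⟨h0, h1, h2⟩
    constructor
    · intro j s u h
      rw [hEdge, hCell_mem_cells]
      cases s
      · have : j.val ≠ 0 := fun hj => by simp [hDegree_eq_zero.1 (h0 j hj) u] at h
        simp only [Bool.false_eq_true, if_false]
        omega
      · have : j.val + 1 ≠ m + 1 := fun hj => by simp [hDegree_eq_zero.1 (h1 j hj) u] at h
        simp only [if_true]
        omega
    · intro j hj
      rw [hCell_mem_cells] at hj
      lift j to ℕ using hj.2.2.1
      exact (X.existsUnique_rel_hCell (j := ⟨j, by omega⟩) (k := ⟨j + 1, by omega⟩) rfl).2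
        (h2 _ _ rfl)
  · rintro ⟨h1, h2⟩
    refine ⟨fun j hj => hDegree_eq_zero.2 fun u => ?_, fun j hj => hDegree_eq_zero.2 fun u => ?_,
      fun j k hk => (X.existsUnique_rel_hCell hk).1 (h2 _ ?_)⟩
    · by_contra h
      have := h1 j false u (by simpa using h)
      rw [hEdge, hCell_mem_cells] at this
      simp only [Bool.false_eq_true, if_false] at this
      omega
    · by_contra h
      have := h1 j true u (by simpa using h)
      rw [hEdge, hCell_mem_cells] at this
      simp only [if_true] at this
      omega
    · rw [hCell_mem_cells]
      omega

theorem Config.isLineCover_col_iff {m : ℕ} (X : Config (m + 1)) (j : Fin (m + 1)) :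
    IsLineCover (fun i => vDegree (X i j) false) (fun i => vDegree (X i j) true) ↔
      (∀ i s u, X i j s u = true → vEdge m (i : ℕ) (j : ℕ) u ∈ cells m) ∧
        ∀ i, vCell m i (j : ℕ) ∈ cells m → ∃! w, X.Rel w (vCell m i (j : ℕ)) := by
  constructor
  · rintro ⟨h0, h1, h2⟩
    constructor
    · intro i s u h
      rw [vEdge, vCell_mem_cells]
      cases u
      · have : i.val ≠ 0 := fun hi => by simp [vDegree_eq_zero.1 (h0 i hi) s] at h
        simp only [Bool.false_eq_true, if_false]
        omega
      · have : i.val + 1 ≠ m + 1 := fun hi => by simp [vDegree_eq_zero.1 (h1 i hi) s] at h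
        simp only [if_true]
        omega
    · intro i hi
      rw [vCell_mem_cells] at hi
      lift i to ℕ using hi.1
      exact (X.existsUnique_rel_vCell (i := ⟨i, by omega⟩) (k := ⟨i + 1, by omega⟩) rfl).2
        (h2 _ _ rfl)
  · rintro ⟨h1, h2⟩
    refine ⟨fun i hi => vDegree_eq_zero.2 fun s => ?_, fun i hi => vDegree_eq_zero.2 fun s => ?_,
      fun i k hk => (X.existsUnique_rel_vCell hk).1 (h2 _ ?_)⟩
    · by_contra h
      have := h1 i s false (by simpa using h)
      rw [vEdge, vCell_mem_cells] at this
      simp only [Bool.false_eq_true, if_false] at this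
      omega
    · by_contra h
      have := h1 i s true (by simpa using h)
      rw [vEdge, vCell_mem_cells] at this
      simp only [if_true] at this
      omega
    · rw [vCell_mem_cells]
      omega

theorem isCover_iff_rel {m : ℕ} (X : Config (m + 1)) :
    IsCover X ↔ (∀ c d, X.Rel c d → c ∈ cells m ∧ d ∈ cells m) ∧
      (∀ i j, hCell m i j ∈ cells m → ∃! w, X.Rel (hCell m i j) w) ∧
        ∀ i j, vCell m i j ∈ cells m → ∃! w, X.Rel w (vCell m i j) := by
  simp only [IsCover, Config.isLineCover_row_iff, Config.isLineCover_col_iff]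
  constructor
  · rintro ⟨h1, h2⟩
    refine ⟨?_, fun i j h => ?_, fun i j h => ?_⟩
    · rintro c d ⟨i, j, s, u, h, rfl, rfl⟩
      exact ⟨(h1 i).1 j s u h, (h2 j).1 i s u h⟩
    · have h' := hCell_mem_cells.1 h
      lift i to ℕ using h'.1
      exact (h1 ⟨i, by omega⟩).2 j h
    · have h' := vCell_mem_cells.1 h
      lift j to ℕ using h'.2.2.1
      exact (h2 ⟨j, by omega⟩).2 i h
  · rintro ⟨h0, h1, h2⟩
    exact ⟨fun i => ⟨fun j s u h => (h0 _ _ ⟨i, j, s, u, h, rfl, rfl⟩).1, h1 _⟩,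
      fun j => ⟨fun i s u h => (h0 _ _ ⟨i, j, s, u, h, rfl, rfl⟩).2, fun i => h2 i _⟩⟩

/-! ### The bijection between perfect matchings and covers -/

/-- The unit squares `c` and `d` are matched by `M`. -/
def Matched {m : ℕ} (M : (graph m).Subgraph) (c d : ℤ × ℤ) : Prop :=
  ∃ (hc : c ∈ cells m) (hd : d ∈ cells m), M.Adj ⟨c, hc⟩ ⟨d, hd⟩

theorem Matched.symm {m : ℕ} {M : (graph m).Subgraph} {c d : ℤ × ℤ} (h : Matched M c d) :
    Matched M d c := by
  obtain ⟨hc, hd, h⟩ := h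
  exact ⟨hd, hc, h.symm⟩

theorem Matched.cellAdj {m : ℕ} {M : (graph m).Subgraph} {c d : ℤ × ℤ} (h : Matched M c d) :
    CellAdj c d := by
  obtain ⟨hc, hd, h⟩ := h
  exact M.adj_sub h

theorem isPerfectMatching_iff_matched {m : ℕ} {M : (graph m).Subgraph} :
    M.IsPerfectMatching ↔ ∀ c ∈ cells m, ∃! d, Matched M c d := by
  rw [SimpleGraph.Subgraph.isPerfectMatching_iff]
  constructor
  · intro h c hc
    obtain ⟨d, hd, hu⟩ := h ⟨c, hc⟩
    refine ⟨d, ⟨hc, d.2, hd⟩, ?_⟩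
    rintro e ⟨_, he, h'⟩
    exact congrArg Subtype.val (hu ⟨e, he⟩ h')
  · rintro h ⟨c, hc⟩
    obtain ⟨d, ⟨_, hd, h'⟩, hu⟩ := h c hc
    exact ⟨⟨d, hd⟩, h', fun e he => Subtype.ext (hu e ⟨hc, e.2, he⟩)⟩

open Classical in
/-- The configuration of a set of edges of the Aztec diamond graph. -/
noncomputable def toConfig {m : ℕ} (M : (graph m).Subgraph) : Config (m + 1) :=
  fun i j s u => decide (Matched M (hEdge m (i : ℕ) (j : ℕ) s) (vEdge m (i : ℕ) (j : ℕ) u))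

theorem toConfig_eq_true_iff {m : ℕ} {M : (graph m).Subgraph} {i j : Fin (m + 1)} {s u : Bool} :
    toConfig M i j s u = true ↔
      Matched M (hEdge m (i : ℕ) (j : ℕ) s) (vEdge m (i : ℕ) (j : ℕ) u) := by
  simp only [toConfig, decide_eq_true_iff]

/-- No matched pair is lost: a partner of a horizontal square is vertical and meets it at a point of
the grid. -/
theorem toConfig_rel_hCell {m : ℕ} {M : (graph m).Subgraph} {i j : ℤ} {d : ℤ × ℤ} :
    (toConfig M).Rel (hCell m i j) d ↔ Matched M (hCell m i j) d := by
  constructor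
  · rintro ⟨a, b, s, u, h, h1, h2⟩
    rw [h1, h2]
    exact toConfig_eq_true_iff.1 h
  · intro h
    obtain ⟨k, l, rfl | rfl⟩ := exists_eq_hCell_or_vCell m d
    · exact absurd h.cellAdj not_cellAdj_hCell_hCell
    · obtain ⟨a, b, s, u, h1, h2⟩ := exists_of_cellAdj h.cellAdj
      rw [h1, h2] at h ⊢
      obtain ⟨hc, hd, -⟩ := id h
      obtain ⟨a, b, rfl, rfl⟩ := mem_of_edges_mem hc hd
      rw [Config.rel_edges]
      exact toConfig_eq_true_iff.2 h

theorem toConfig_rel_vCell {m : ℕ} {M : (graph m).Subgraph} {i j : ℤ} {c : ℤ × ℤ} :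
    (toConfig M).Rel c (vCell m i j) ↔ Matched M (vCell m i j) c := by
  obtain ⟨k, l, rfl | rfl⟩ := exists_eq_hCell_or_vCell m c
  · rw [toConfig_rel_hCell]
    exact ⟨Matched.symm, Matched.symm⟩
  · constructor
    · rintro ⟨a, b, s, u, -, h, -⟩
      exact absurd h.symm hCell_ne_vCell
    · intro h
      exact absurd h.cellAdj not_cellAdj_vCell_vCell

theorem isCover_toConfig {m : ℕ} {M : (graph m).Subgraph} (hM : M.IsPerfectMatching) :
    IsCover (toConfig M) := by
  rw [isPerfectMatching_iff_matched] at hM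
  rw [isCover_iff_rel]
  simp only [toConfig_rel_hCell, toConfig_rel_vCell]
  refine ⟨?_, fun i j => hM _, fun i j => hM _⟩
  rintro c d ⟨i, j, s, u, h, rfl, rfl⟩
  obtain ⟨hc, hd, -⟩ := toConfig_eq_true_iff.1 h
  exact ⟨hc, hd⟩

theorem matched_iff_toConfig_rel {m : ℕ} {M : (graph m).Subgraph} {c d : ℤ × ℤ} :
    Matched M c d ↔ (toConfig M).Rel c d ∨ (toConfig M).Rel d c := by
  obtain ⟨i, j, rfl | rfl⟩ := exists_eq_hCell_or_vCell m c
  · rw [toConfig_rel_hCell, iff_self_or]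
    rintro ⟨a, b, s, u, -, -, h⟩
    exact absurd h hCell_ne_vCell
  · rw [toConfig_rel_vCell, iff_or_self]
    rintro ⟨a, b, s, u, -, h, -⟩
    exact absurd h.symm hCell_ne_vCell

/-- Perfect matchings span all vertices, so their adjacency determines them, and the configuration
records it. -/
theorem toConfig_injective {m : ℕ} {M N : (graph m).Subgraph} (hM : M.IsPerfectMatching)
    (hN : N.IsPerfectMatching) (h : toConfig M = toConfig N) : M = N := by
  refine SimpleGraph.Subgraph.ext ?_ ?_
  · rw [hM.2.verts_eq_univ, hN.2.verts_eq_univ]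
  · ext c d
    have key : Matched M c d ↔ Matched N c d := by
      rw [matched_iff_toConfig_rel, matched_iff_toConfig_rel, h]
    exact ⟨fun h' => (key.1 ⟨c.2, d.2, h'⟩).2.2, fun h' => (key.2 ⟨c.2, d.2, h'⟩).2.2⟩

theorem Config.Rel.cellAdj {m : ℕ} {X : Config (m + 1)} {c d : ℤ × ℤ} (h : X.Rel c d) :
    CellAdj c d := by
  obtain ⟨i, j, s, u, -, rfl, rfl⟩ := h
  exact cellAdj_hEdge_vEdge

/-- The spanning subgraph whose edges are those used by the configuration `X`. -/
def ofConfig {m : ℕ} (X : Config (m + 1)) : (graph m).Subgraph where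
  verts := Set.univ
  Adj c d := X.Rel c d ∨ X.Rel d c
  adj_sub h := h.elim (fun h => h.cellAdj) fun h => h.cellAdj.symm
  edge_vert _ := Set.mem_univ _
  symm := ⟨fun _ _ h => h.symm⟩

theorem matched_ofConfig {m : ℕ} {X : Config (m + 1)} (hX : IsCover X) {c d : ℤ × ℤ} :
    Matched (ofConfig X) c d ↔ X.Rel c d ∨ X.Rel d c := by
  have h := ((isCover_iff_rel X).1 hX).1
  refine ⟨fun ⟨_, _, h⟩ => h, ?_⟩
  rintro (h' | h')
  · exact ⟨(h _ _ h').1, (h _ _ h').2, Or.inl h'⟩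
  · exact ⟨(h _ _ h').2, (h _ _ h').1, Or.inr h'⟩

theorem matched_ofConfig_hCell {m : ℕ} {X : Config (m + 1)} (hX : IsCover X) {i j : ℤ}
    {d : ℤ × ℤ} : Matched (ofConfig X) (hCell m i j) d ↔ X.Rel (hCell m i j) d := by
  rw [matched_ofConfig hX, or_iff_left]
  rintro ⟨a, b, s, u, -, -, h⟩
  exact hCell_ne_vCell h

theorem matched_ofConfig_vCell {m : ℕ} {X : Config (m + 1)} (hX : IsCover X) {i j : ℤ}
    {d : ℤ × ℤ} : Matched (ofConfig X) (vCell m i j) d ↔ X.Rel d (vCell m i j) := by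
  rw [matched_ofConfig hX, or_iff_right]
  rintro ⟨a, b, s, u, -, h, -⟩
  exact hCell_ne_vCell h.symm

theorem isPerfectMatching_ofConfig {m : ℕ} {X : Config (m + 1)} (hX : IsCover X) :
    (ofConfig X).IsPerfectMatching := by
  obtain ⟨-, h1, h2⟩ := (isCover_iff_rel X).1 hX
  rw [isPerfectMatching_iff_matched]
  intro c hc
  obtain ⟨i, j, rfl | rfl⟩ := exists_eq_hCell_or_vCell m c
  · simpa only [matched_ofConfig_hCell hX] using h1 i j hc
  · simpa only [matched_ofConfig_vCell hX] using h2 i j hc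

theorem toConfig_ofConfig {m : ℕ} {X : Config (m + 1)} (hX : IsCover X) :
    toConfig (ofConfig X) = X := by
  funext i j s u
  rw [Bool.eq_iff_iff, toConfig_eq_true_iff, ← X.rel_edges]
  exact matched_ofConfig_hCell hX

theorem numPerfectMatchings_graph (m : ℕ) :
    numPerfectMatchings (graph m) = Nat.card {X : Config (m + 1) // IsCover X} :=
  Nat.card_congr
    { toFun := fun M => ⟨toConfig M.1, isCover_toConfig M.2⟩
      invFun := fun X => ⟨ofConfig X.1, isPerfectMatching_ofConfig X.2⟩
      left_inv := fun M => Subtype.ext (toConfig_injective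
        (isPerfectMatching_ofConfig (isCover_toConfig M.2)) M.2
        (toConfig_ofConfig (isCover_toConfig M.2)))
      right_inv := fun X => Subtype.ext (toConfig_ofConfig X.2) }

end AztecASM

theorem mainTheorem4 (n : ℕ) (hn : 1 ≤ n) :
    AztecASM.numPerfectMatchings (AztecASM.graph (n - 1)) =
      ∑ A ∈ AztecASM.asm n, 2 ^ AztecASM.numNegOnes A := by
  obtain ⟨m, rfl⟩ := Nat.exists_eq_add_of_le' hn
  rw [Nat.add_sub_cancel, AztecASM.numPerfectMatchings_graph, AztecASM.card_isCover m.succ_pos]
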